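/- Let $K$ be a quadratically closed field, i.e. a field in which every quadratic equation $x^2+ax+b=0$ with $a,b\in K$ has a root in $K$. Let $G$ be a finitely generated group, and let $f:G\to K$ be a $K$-trace function, i.e. a function such that $f(xy)+f(x^{-1}y)=f(x)f(y)$ for all $x,y\in G$ and $f(\mathrm{id})=2$, where $\mathrm{id}$ is the identity element of $G$. Then $f$ is the character of an $SL(2,K)$ representation of $G$: there is a group homomorphism $\rho:G\to SL(2,K)$ such that $f(g)=\operatorname{tr}\rho(g)$ for all $g\in G$. -/

import Mathlib

/-- A field `K` is quadratically closed if each quadratic equation `x ^ 2 + a x + b = 0` with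
coefficients in `K` has a root in `K`. -/
def IsQuadraticallyClosed (K : Type*) [Field K] : Prop :=
  ∀ a b : K, ∃ x : K, x ^ 2 + a * x + b = 0

/-- A `K`-trace function on a group `G`. -/
structure IsTraceFunction {G K : Type*} [Group G] [Field K] (f : G → K) : Prop where
  mul_add_inv_mul : ∀ x y : G, f (x * y) + f (x⁻¹ * y) = f x * f y
  map_one : f 1 = 2

/-- The character of a representation `ρ : G → SL(2, K)`. -/
def slCharacter {G K : Type*} [Group G] [Field K]
    (ρ : G →* Matrix.SpecialLinearGroup (Fin 2) K) : G → K :=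
  fun g => (ρ g : Matrix (Fin 2) (Fin 2) K).trace

/-! ### Trace identities on the group -/

namespace IsTraceFunction

variable {G K : Type*} [Group G] [Field K] {f : G → K}

/-! Extended linearly to `K[G]`, `f` behaves like the trace of 2×2 matrices modulo the radical of
its trace form. If `f x ^ 2 ≠ 4`, then `X ^ 2 - f x * X + 1` has distinct roots in `K`, and the
eigenprojection `e` of `x` is an idempotent of trace one modulo that radical. In the Peirce
decomposition along `e`, the diagonal corners are scalar (`map_corner`) and the off-diagonal pairing
has rank at most one (`map_mixed_mul_mixed`), so it factors into column times row and gives the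
matrix entries. If `f ^ 2 = 4` everywhere, `f` comes from a scalar representation, trivial when `2 =
0`. -/

theorem map_inv (hf : IsTraceFunction f) (x : G) : f x⁻¹ = f x := by
  have h := hf.mul_add_inv_mul x 1
  rw [mul_one, mul_one, hf.map_one] at h
  linear_combination h

theorem map_mul_comm (hf : IsTraceFunction f) (x y : G) : f (x * y) = f (y * x) := by
  have h₁ := hf.mul_add_inv_mul x y
  have h₂ := hf.mul_add_inv_mul y x
  have h₃ := hf.map_inv (x⁻¹ * y)
  rw [mul_inv_rev, inv_inv] at h₃
  linear_combination h₁ - h₂ + h₃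

/-- The fundamental trace identity, i.e. the polarised Cayley–Hamilton identity. -/
theorem map_mul_mul_add (hf : IsTraceFunction f) (x y z : G) :
    f (x * y * z) + f (y * x * z) =
      f x * f (y * z) + f y * f (x * z) + (f (x * y) - f x * f y) * f z := by
  have h₁ := hf.mul_add_inv_mul x (y * z)
  have h₂ := hf.mul_add_inv_mul (x⁻¹ * y) z
  have h₃ := hf.mul_add_inv_mul y (x * z)
  have h₄ := hf.mul_add_inv_mul x y
  simp only [mul_inv_rev, inv_inv, mul_assoc] at *
  linear_combination h₁ - h₂ + h₃ - f z * h₄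

theorem map_sq (hf : IsTraceFunction f) (x y : G) :
    f (x * (x * y)) = f x * f (x * y) - f y := by
  have h := hf.mul_add_inv_mul x (x * y)
  rw [inv_mul_cancel_left] at h
  linear_combination h

end IsTraceFunction

/-- An abstract two-dimensional trace on a `K`-algebra. -/
structure IsAlgebraTrace {K A : Type*} [Field K] [Ring A] [Algebra K A] (t : A →ₗ[K] K) :
    Prop where
  map_one : t 1 = 2
  map_mul_comm : ∀ a b, t (a * b) = t (b * a)
  map_mul_mul_add : ∀ a b c, t (a * b * c) + t (b * a * c) =
    t a * t (b * c) + t b * t (a * c) + (t (a * b) - t a * t b) * t c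

/-- The linear extension of a function on a group to the group algebra. -/
noncomputable def groupAlgebraExtension {G K : Type*} [Group G] [Field K] (f : G → K) :
    MonoidAlgebra K G →ₗ[K] K :=
  (Finsupp.linearCombination K f).comp (MonoidAlgebra.coeffLinearEquiv K).toLinearMap

@[simp]
theorem groupAlgebraExtension_single {G K : Type*} [Group G] [Field K] (f : G → K)
    (g : G) (r : K) : groupAlgebraExtension f (MonoidAlgebra.single g r) = r * f g := by
  change Finsupp.linearCombination K f (Finsupp.single g r) = _
  simp

/-! ### The trace form on the group algebra -/

namespace IsTraceFunction

variable {G K : Type*} [Group G] [Field K] {f : G → K}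

theorem isAlgebraTrace (hf : IsTraceFunction f) : IsAlgebraTrace (groupAlgebraExtension f) where
  map_one := by simp [MonoidAlgebra.one_def, hf.map_one]
  map_mul_comm a b := by
    induction a using MonoidAlgebra.induction_linear with
    | zero => simp
    | add a a' h h' => simp only [add_mul, mul_add, map_add, h, h']
    | single x r =>
      induction b using MonoidAlgebra.induction_linear with
      | zero => simp
      | add b b' h h' => simp only [add_mul, mul_add, map_add, h, h']
      | single y s =>
        simp only [MonoidAlgebra.single_mul_single, groupAlgebraExtension_single,
          hf.map_mul_comm x y, mul_comm r s]
  map_mul_mul_add a b c := by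
    induction a using MonoidAlgebra.induction_linear with
    | zero => simp
    | add a a' h h' =>
      simp only [add_mul, mul_add, map_add]
      linear_combination h + h'
    | single x r =>
      induction b using MonoidAlgebra.induction_linear with
      | zero => simp
      | add b b' h h' =>
        simp only [add_mul, mul_add, map_add]
        linear_combination h + h'
      | single y s =>
        induction c using MonoidAlgebra.induction_linear with
        | zero => simp
        | add c c' h h' =>
          simp only [mul_add, map_add]
          linear_combination h + h'
        | single z q =>
          simp only [MonoidAlgebra.single_mul_single, groupAlgebraExtension_single]
          linear_combination r * s * q * hf.map_mul_mul_add x y z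

/-- Cayley–Hamilton modulo the radical: `x ^ 2 - f x * x + 1` pairs to zero with every `w`. This
gives both the idempotent and determinant one. -/
theorem extension_sq (hf : IsTraceFunction f) (x : G) (w : MonoidAlgebra K G) :
    groupAlgebraExtension f (MonoidAlgebra.of K G x * (MonoidAlgebra.of K G x * w)) =
      f x * groupAlgebraExtension f (MonoidAlgebra.of K G x * w) - groupAlgebraExtension f w := by
  induction w using MonoidAlgebra.induction_linear with
  | zero => simp
  | add a a' h h' =>
    simp only [mul_add, map_add]
    linear_combination h + h'
  | single y r =>
    simp only [MonoidAlgebra.of_apply, MonoidAlgebra.single_mul_single,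
      groupAlgebraExtension_single]
    linear_combination r * hf.map_sq x y

end IsTraceFunction

/-- `e` acts as an idempotent of trace one, up to the radical of the trace form of `t`. -/
structure IsTraceIdempotent {K A : Type*} [Field K] [Ring A] [Algebra K A] (t : A →ₗ[K] K)
    (e : A) : Prop where
  map_eq_one : t e = 1
  map_mul_self_mul : ∀ w, t (e * (e * w)) = t (e * w)

/-! ### Peirce decomposition along a trace idempotent -/

namespace IsTraceIdempotent

variable {K A : Type*} [Field K] [Ring A] [Algebra K A] {t : A →ₗ[K] K} {e : A}

theorem one_sub (ht : IsAlgebraTrace t) (he : IsTraceIdempotent t e) :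
    IsTraceIdempotent t (1 - e) where
  map_eq_one := by
    rw [map_sub, ht.map_one, he.map_eq_one]
    ring
  map_mul_self_mul w := by
    have h := he.map_mul_self_mul w
    simp only [sub_mul, mul_sub, map_sub, one_mul]
    linear_combination h

/-- Compressing to a trace idempotent is scalar multiplication. -/
theorem map_corner (ht : IsAlgebraTrace t) (he : IsTraceIdempotent t e) (s w : A) :
    t (e * s * e * w) = t (e * s) * t (e * w) := by
  -- Since `t e = 1`, all terms of the identity except the two wanted ones cancel.
  have h := ht.map_mul_mul_add e s (w * e)
  have h₁ : t (e * s * (w * e)) = t (e * (s * w)) := by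
    rw [← he.map_mul_self_mul, ← mul_assoc, ht.map_mul_comm]
    simp only [mul_assoc]
  have h₂ : t (s * e * (w * e)) = t (e * s * e * w) := by
    rw [← mul_assoc, ht.map_mul_comm]
    simp only [mul_assoc]
  have h₃ : t (e * (w * e)) = t (e * w) := by
    rw [ht.map_mul_comm, mul_assoc, ht.map_mul_comm w, mul_assoc, he.map_mul_self_mul]
  have h₄ : t (s * (w * e)) = t (e * (s * w)) := by
    rw [← mul_assoc, ht.map_mul_comm]
  rw [h₁, h₂, h₃, h₄, ht.map_mul_comm w e, he.map_eq_one] at h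
  linear_combination h

/-- The off-diagonal part of the product has rank one. -/
theorem map_mixed_mul_mixed (ht : IsAlgebraTrace t) {e' : A} (he : IsTraceIdempotent t e)
    (he' : IsTraceIdempotent t e') (g h g₀ h₀ : A) :
    t (e * g * e' * h) * t (e * g₀ * e' * h₀) =
      t (e * g * e' * h₀) * t (e * g₀ * e' * h) := by
  -- The cyclic word `e g e' h e g₀ e' h₀` has two factorisations: cut at the two `e`, or at the two
  -- `e'`.
  have h₁ := he.map_corner ht (g * e' * h) (g₀ * e' * h₀)
  have h₂ := he'.map_corner ht (h * e * g₀) (h₀ * e * g)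
  have h₃ : t (e * (g * e' * h) * e * (g₀ * e' * h₀)) =
      t (e' * (h * e * g₀) * e' * (h₀ * e * g)) := by
    rw [show e * (g * e' * h) * e * (g₀ * e' * h₀) =
      (e * g) * (e' * (h * e * g₀) * e' * h₀) by simp only [mul_assoc], ht.map_mul_comm]
    simp only [mul_assoc]
  have h₄ (u v : A) : t (e' * (u * e * v)) = t (e * v * e' * u) := by
    rw [show e' * (u * e * v) = (e' * u) * (e * v) by simp only [mul_assoc], ht.map_mul_comm]
    simp only [mul_assoc]
  rw [h₄, h₄] at h₂
  simp only [mul_assoc] at *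
  linear_combination h₂ - h₁ + h₃

theorem map_mul_one_sub (he : IsTraceIdempotent t e) (w : A) : t (e * ((1 - e) * w)) = 0 := by
  rw [sub_mul, mul_sub, map_sub, one_mul, he.map_mul_self_mul, sub_self]

theorem map_mul_split (e u v : A) :
    t (u * v) = t (u * e * v) + t (u * (1 - e) * v) := by
  rw [← map_add, ← add_mul, ← mul_add, add_sub_cancel, mul_one]

/-- The matrix of `g` with respect to a trace idempotent `e` and base points `g₀`, `h₀`. -/
noncomputable def matrix (t : A →ₗ[K] K) (e g₀ h₀ g : A) : Matrix (Fin 2) (Fin 2) K :=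
  !![t (e * g), t (e * g * (1 - e) * h₀) / t (e * g₀ * (1 - e) * h₀);
    t (e * g₀ * (1 - e) * g), t ((1 - e) * g)]

theorem matrix_trace (e g₀ h₀ g : A) : (matrix t e g₀ h₀ g).trace = t g := by
  simp only [matrix, Matrix.trace_fin_two_of]
  rw [← map_add, ← add_mul, add_sub_cancel, one_mul]

variable {g₀ h₀ : A}

theorem matrix_one (ht : IsAlgebraTrace t) (he : IsTraceIdempotent t e) :
    matrix t e g₀ h₀ 1 = 1 := by
  have hc : t (e * g₀ * (1 - e)) = 0 := by
    have h := (he.one_sub ht).map_mul_one_sub g₀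
    rw [sub_sub_cancel] at h
    rw [ht.map_mul_comm, h]
  have hb : t (e * (1 - e) * h₀) = 0 := by rw [mul_assoc, he.map_mul_one_sub]
  simp only [matrix, mul_one, he.map_eq_one, (he.one_sub ht).map_eq_one, hc, hb, zero_div,
    Matrix.one_fin_two]

/-- `hβ` covers a zero denominator: the whole pairing then vanishes. -/
theorem offDiag_mul (ht : IsAlgebraTrace t) (he : IsTraceIdempotent t e)
    (hβ : t (e * g₀ * (1 - e) * h₀) = 0 → ∀ g h, t (e * g * (1 - e) * h) = 0) (g h : A) :
    t (e * g * (1 - e) * h₀) / t (e * g₀ * (1 - e) * h₀) * t (e * g₀ * (1 - e) * h) =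
      t (e * g * (1 - e) * h) := by
  by_cases h0 : t (e * g₀ * (1 - e) * h₀) = 0
  · simp only [hβ h0, mul_zero]
  · rw [div_mul_eq_mul_div, div_eq_iff h0]
    exact (he.map_mixed_mul_mixed ht (he.one_sub ht) g h g₀ h₀).symm

/-- Inserting `e + (1 - e)` between `g` and `h` splits each entry into the two terms of a matrix
product. -/
theorem matrix_mul (ht : IsAlgebraTrace t) (he : IsTraceIdempotent t e)
    (hβ : t (e * g₀ * (1 - e) * h₀) = 0 → ∀ g h, t (e * g * (1 - e) * h) = 0) (g h : A) :
    matrix t e g₀ h₀ (g * h) = matrix t e g₀ h₀ g * matrix t e g₀ h₀ h := by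
  have he' := he.one_sub ht
  have hbc := offDiag_mul ht he hβ
  have ha : t (e * (g * h)) = t (e * g) * t (e * h) + t (e * g * (1 - e) * h) := by
    rw [← mul_assoc, map_mul_split e, he.map_corner ht]
  have hd : t ((1 - e) * (g * h)) =
      t (e * h * (1 - e) * g) + t ((1 - e) * g) * t ((1 - e) * h) := by
    rw [← mul_assoc, map_mul_split e, he'.map_corner ht, mul_assoc ((1 - e) * g) e h,
      ht.map_mul_comm ((1 - e) * g), ← mul_assoc]
  have hb : t (e * (g * h) * (1 - e) * h₀) =
      t (e * g) * t (e * h * (1 - e) * h₀) + t (e * g * (1 - e) * h₀) * t ((1 - e) * h) := by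
    have h₁ := he.map_corner ht g (h * (1 - e) * h₀)
    have h₂ := he'.map_corner ht h (h₀ * (e * g))
    have h₃ := map_mul_split (t := t) e (e * g) (h * (1 - e) * h₀)
    have h₄ : t ((1 - e) * h * (1 - e) * (h₀ * (e * g))) =
        t (e * g * (1 - e) * (h * (1 - e) * h₀)) := by
      rw [← mul_assoc, ht.map_mul_comm]
      simp only [mul_assoc]
    have h₅ : t ((1 - e) * (h₀ * (e * g))) = t (e * g * (1 - e) * h₀) := by
      rw [← mul_assoc, ht.map_mul_comm]
      simp only [mul_assoc]
    rw [h₄, h₅] at h₂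
    simp only [← mul_assoc] at *
    linear_combination h₁ + h₂ + h₃
  have hc : t (e * g₀ * (1 - e) * (g * h)) =
      t (e * g₀ * (1 - e) * g) * t (e * h) + t ((1 - e) * g) * t (e * g₀ * (1 - e) * h) := by
    have h₁ := he.map_corner ht (g₀ * (1 - e) * g) h
    have h₂ := he'.map_corner ht g (h * (e * g₀))
    have h₃ := map_mul_split (t := t) e (e * g₀ * (1 - e) * g) h
    have h₄ : t ((1 - e) * g * (1 - e) * (h * (e * g₀))) =
        t (e * g₀ * (1 - e) * g * (1 - e) * h) := by
      rw [← mul_assoc, ht.map_mul_comm]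
      simp only [mul_assoc]
    have h₅ : t ((1 - e) * (h * (e * g₀))) = t (e * g₀ * (1 - e) * h) := by
      rw [← mul_assoc, ht.map_mul_comm]
      simp only [mul_assoc]
    rw [h₄, h₅] at h₂
    simp only [← mul_assoc] at *
    linear_combination h₁ + h₂ + h₃
  have h₁ := hbc g h
  have h₂ := hbc h g
  simp only [matrix, Matrix.mul_fin_two, ha, hd, hb, hc]
  rw [← h₁, ← h₂]
  ext i j
  fin_cases i <;> fin_cases j <;> simp <;> ring

end IsTraceIdempotent

/-- A root of the characteristic polynomial which is distinct from its inverse yields a trace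
idempotent in the group algebra. -/
theorem IsTraceFunction.exists_isTraceIdempotent {G K : Type*} [Group G] [Field K] {f : G → K}
    (hf : IsTraceFunction f) (x : G) {l m : K} (hlm : l ≠ m) (hsum : l + m = f x)
    (hprod : l * m = 1) :
    ∃ e, IsTraceIdempotent (groupAlgebraExtension f) e := by
  have h0 : l - m ≠ 0 := sub_ne_zero.mpr hlm
  -- The projection onto the `l`-eigenspace of `x` along the `m`-eigenspace.
  refine ⟨(l - m)⁻¹ • (MonoidAlgebra.of K G x - m • 1), ?_, fun w => ?_⟩
  · simp only [map_smul, map_sub, hf.isAlgebraTrace.map_one, MonoidAlgebra.of_apply,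
      groupAlgebraExtension_single, smul_eq_mul, one_mul, ← hsum]
    field_simp
    ring
  · have h := hf.extension_sq x w
    simp only [smul_mul_assoc, mul_smul_comm, sub_mul, mul_sub, one_mul, map_smul, map_sub,
      smul_eq_mul]
    rw [h, ← hsum]
    field_simp
    linear_combination groupAlgebraExtension f w * hprod

/-- A trace function whose group algebra has a trace idempotent comes from a representation. -/
theorem IsTraceFunction.exists_slCharacter_eq_of_isTraceIdempotent {G K : Type*} [Group G]
    [Field K] {f : G → K} (hf : IsTraceFunction f) {e : MonoidAlgebra K G}
    (he : IsTraceIdempotent (groupAlgebraExtension f) e) :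
    ∃ ρ : G →* Matrix.SpecialLinearGroup (Fin 2) K, slCharacter ρ = f := by
  have ht := hf.isAlgebraTrace
  -- If the off-diagonal pairing is identically zero, any base points serve and the representation
  -- is diagonal.
  obtain ⟨g₀, h₀, hβ⟩ : ∃ g₀ h₀ : MonoidAlgebra K G,
      groupAlgebraExtension f (e * g₀ * (1 - e) * h₀) = 0 →
        ∀ g h, groupAlgebraExtension f (e * g * (1 - e) * h) = 0 := by
    by_cases h : ∃ g₀ h₀ : MonoidAlgebra K G, groupAlgebraExtension f (e * g₀ * (1 - e) * h₀) ≠ 0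
    · obtain ⟨g₀, h₀, h⟩ := h
      exact ⟨g₀, h₀, fun h' => absurd h' h⟩
    · push Not at h
      exact ⟨1, 1, fun _ => h⟩
  let M (g : G) := IsTraceIdempotent.matrix (groupAlgebraExtension f) e g₀ h₀
    (MonoidAlgebra.of K G g)
  have hmul (g h : G) : M (g * h) = M g * M h := by
    simp only [M, map_mul, IsTraceIdempotent.matrix_mul ht he hβ]
  have hdet (g : G) : (M g).det = 1 := by
    -- With `a`, `d` the diagonal entries and `f g = a + d`, the product of the off-diagonal entries
    -- is `t (e g g) - a ^ 2`, so the determinant is `a * f g - t (e g g)`, which is `t e = 1` by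
    -- Cayley–Hamilton.
    have h₁ := hf.extension_sq g e
    have h₂ := IsTraceIdempotent.offDiag_mul ht he hβ (MonoidAlgebra.of K G g)
      (MonoidAlgebra.of K G g)
    have h₃ := IsTraceIdempotent.map_mul_split (t := groupAlgebraExtension f) e
      (e * MonoidAlgebra.of K G g) (MonoidAlgebra.of K G g)
    have h₄ := IsTraceIdempotent.map_mul_split (t := groupAlgebraExtension f) e
      1 (MonoidAlgebra.of K G g)
    rw [he.map_corner ht] at h₃
    rw [he.map_eq_one, ← mul_assoc, ht.map_mul_comm _ e, ht.map_mul_comm _ e, ← mul_assoc] at h₁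
    simp only [one_mul] at h₄
    rw [MonoidAlgebra.of_apply, groupAlgebraExtension_single, one_mul] at h₄
    simp only [M, IsTraceIdempotent.matrix, Matrix.det_fin_two_of]
    simp only [MonoidAlgebra.of_apply] at *
    rw [h₂]
    linear_combination -h₁ + h₃ - groupAlgebraExtension f (e * MonoidAlgebra.single g 1) * h₄
  refine ⟨{ toFun := fun g => ⟨M g, hdet g⟩, map_one' := ?_, map_mul' := fun g h => ?_ }, ?_⟩
  · ext1
    simp only [M, (MonoidAlgebra.of K G).map_one, IsTraceIdempotent.matrix_one ht he,
      Matrix.SpecialLinearGroup.coe_one]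
  · exact Subtype.ext (hmul g h)
  · funext g
    change (M g).trace = f g
    simp only [M, IsTraceIdempotent.matrix_trace, MonoidAlgebra.of_apply,
      groupAlgebraExtension_single, one_mul]

/-- A trace function with values in `{2, -2}` is the character of a scalar representation. -/
theorem IsTraceFunction.exists_slCharacter_eq_of_forall_sq_eq_four {G K : Type*} [Group G]
    [Field K] {f : G → K} (hf : IsTraceFunction f) (h4 : ∀ x, f x ^ 2 = 4) :
    ∃ ρ : G →* Matrix.SpecialLinearGroup (Fin 2) K, slCharacter ρ = f := by
  by_cases h2 : (2 : K) = 0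
  · refine ⟨1, funext fun g => ?_⟩
    have h : f g = 0 := pow_eq_zero_iff two_ne_zero |>.mp <| by
      linear_combination h4 g + 2 * h2
    simp [slCharacter, h, h2]
  · have hmul (x y : G) : f (x * y) / 2 = f x / 2 * (f y / 2) := by
      have h₁ := hf.mul_add_inv_mul x y
      -- Both squares are 4 and the sum `f x * f y` has square 16, so by the parallelogram identity
      -- the difference squares to 0.
      have h₂ : (f (x * y) - f (x⁻¹ * y)) ^ 2 = 0 := by
        linear_combination 2 * h4 (x * y) + 2 * h4 (x⁻¹ * y) -
          (f (x * y) + f (x⁻¹ * y) + f x * f y) * h₁ - f y ^ 2 * h4 x - 4 * h4 y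
      have h₃ := pow_eq_zero_iff two_ne_zero |>.mp h₂
      field_simp
      linear_combination h₁ + h₃
    let M (g : G) : Matrix (Fin 2) (Fin 2) K := !![f g / 2, 0; 0, f g / 2]
    have hdet (g : G) : (M g).det = 1 := by
      simp only [M, Matrix.det_fin_two_of]
      field_simp
      linear_combination h4 g
    refine ⟨{ toFun := fun g => ⟨M g, hdet g⟩, map_one' := ?_, map_mul' := fun g h => ?_ }, ?_⟩
    · ext1
      simp only [M, hf.map_one, div_self h2, Matrix.SpecialLinearGroup.coe_one,
        Matrix.one_fin_two]
    · apply Subtype.ext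
      change M (g * h) = M g * M h
      simp [M, hmul]
    · funext g
      change (M g).trace = f g
      simp only [M, Matrix.trace_fin_two_of]
      field_simp
      ring

theorem proposition8p1 {K : Type*} [Field K] (hK : IsQuadraticallyClosed K)
    {G : Type*} [Group G] (hG : Group.FG G) (f : G → K) (hf : IsTraceFunction f) :
    ∃ ρ : G →* Matrix.SpecialLinearGroup (Fin 2) K, slCharacter ρ = f := by
  by_cases h4 : ∀ x, f x ^ 2 = 4
  · exact hf.exists_slCharacter_eq_of_forall_sq_eq_four h4
  · push Not at h4
    obtain ⟨x, hx⟩ := h4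
    obtain ⟨l, hl⟩ := hK (-f x) 1
    have hprod : l * (f x - l) = 1 := by linear_combination -hl
    -- A double root would force the discriminant `f x ^ 2 - 4` to vanish.
    have hlm : l ≠ f x - l := fun h => hx <| by
      linear_combination 4 * hprod + (f x - 2 * l) * h - 2 * (f x - 2 * l) * h
    obtain ⟨e, he⟩ := hf.exists_isTraceIdempotent x hlm (add_sub_cancel l (f x)) hprod
    exact hf.exists_slCharacter_eq_of_isTraceIdempotent he
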